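/- Let $G$ be a discrete group (of arbitrary cardinality). For $g\in G$ and a function $f\colon G\to\mathbb C$ write ${}^g f(x)=f(g^{-1}x)$. The following conditions are equivalent: 1. $G$ does not admit a paradoxical decomposition; that is, there do not exist pairwise disjoint subsets $A_1,\dots,A_n,B_1,\dots,B_m$ of $G$ and elements $g_1,\dots,g_n,h_1,\dots,h_m\in G$ such that $G=\bigcup_{i} g_iA_i=\bigcup_{j} h_jB_j$. 2. $G$ admits a finitely additive probability measure, defined on the power set $\mathcal P(G)$, which is invariant under left translations. 3. $G$ admits a left-invariant mean, i.e. a positive linear functional $\phi\colon\ell^\infty(G)\to\mathbb C$ on the space of bounded complex-valued functions on $G$, satisfying $\phi(1)=1$ and $\phi({}^g f)=\phi(f)$ for all $g\in G$ and $f\in\ell^\infty(G)$. 4. There is a regular Borel probability measure on the Stone–Čech compactification $\beta G$ which is invariant under the action of $G$ on $\beta G$ by the continuous extensions of the left translations $x\mapsto gx$ of $G$. 5. (Følner's condition) For every finite $F\subseteq G$ and every $\varepsilon>0$ there is a finite $\Phi\subseteq G$ such that $|g\Phi\bigtriangleup\Phi|<\varepsilon|\Phi|$ for each $g\in F$. 6.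 (Reiter's condition (P1)) For every finite $F\subseteq G$ and every $\varepsilon>0$ there is a (complex-valued) $f\in\ell^1(G)$ with $\|f\|_{\ell^1(G)}=1$ and $\|f-{}^g f\|_{\ell^1(G)}<\varepsilon$ for each $g\in F$. -/

import Mathlib

open MeasureTheory Function
open scoped Pointwise ENNReal symmDiff ComplexOrder

/-- `G` admits a paradoxical decomposition: there are subsets `A₁, …, Aₙ, B₁, …, Bₘ` of `G`, all of
them pairwise disjoint, and elements `gᵢ`, `hⱼ` of `G` such that the translates `gᵢAᵢ` cover `G`
and the translates `hⱼBⱼ` cover `G`. -/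
def HasParadoxicalDecomposition (G : Type*) [Group G] : Prop :=
  ∃ (n m : ℕ) (A : Fin n → Set G) (B : Fin m → Set G) (g : Fin n → G) (h : Fin m → G),
    Pairwise (Disjoint on (Sum.elim A B)) ∧
    (⋃ i, g i • A i) = Set.univ ∧ (⋃ j, h j • B j) = Set.univ

/-- `μ` is a finitely additive probability measure, defined on all subsets of `G`, which is
invariant under left translations. -/
structure IsInvariantFinitelyAdditiveProbability {G : Type*} [Group G] (μ : Set G → ℝ) :
    Prop where
  nonneg : ∀ A : Set G, 0 ≤ μ A
  univ : μ Set.univ = 1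
  union : ∀ A B : Set G, Disjoint A B → μ (A ∪ B) = μ A + μ B
  smul : ∀ (g : G) (A : Set G), μ (g • A) = μ A

theorem memℓp_leftTranslate {G : Type*} [Group G] {p : ℝ≥0∞} (g : G) {f : G → ℂ}
    (hf : Memℓp f p) : Memℓp (fun x => f (g⁻¹ * x)) p := by
  rcases p.trichotomy with rfl | rfl | hp
  · rw [memℓp_zero_iff] at hf ⊢
    exact hf.preimage ((mul_right_injective g⁻¹).injOn)
  · rw [memℓp_infty_iff] at hf ⊢
    refine hf.mono ?_
    rintro _ ⟨x, rfl⟩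
    exact ⟨g⁻¹ * x, rfl⟩
  · rw [memℓp_gen_iff hp] at hf ⊢
    exact hf.comp_injective (mul_right_injective g⁻¹)

/-- The left translate `ᵍf` of a function `f ∈ ℓᵖ(G)`, that is, `ᵍf (x) = f (g⁻¹ x)`. -/
def leftTranslate {G : Type*} [Group G] {p : ℝ≥0∞} (g : G) (f : lp (fun _ : G => ℂ) p) :
    lp (fun _ : G => ℂ) p :=
  ⟨fun x => f (g⁻¹ * x), memℓp_leftTranslate g (lp.memℓp f)⟩

/-- A linear functional `φ` on the complex space `ℓ^∞(G)` is a left-invariant mean: it is positive,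
satisfies `φ(1) = 1`, and is invariant under left translations. In `0 ≤ f x` and `0 ≤ φ f` the order
is that of `ℂ`, so these mean "real and nonnegative". -/
structure IsLeftInvariantMean {G : Type*} [Group G] (φ : lp (fun _ : G => ℂ) ∞ →ₗ[ℂ] ℂ) :
    Prop where
  nonneg : ∀ f : lp (fun _ : G => ℂ) ∞, (∀ x, 0 ≤ f x) → 0 ≤ φ f
  map_one : φ 1 = 1
  map_leftTranslate : ∀ (g : G) (f : lp (fun _ : G => ℂ) ∞), φ (leftTranslate g f) = φ f

/-- The Borel σ-algebra on the Stone–Čech compactification. -/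
instance StoneCech.instMeasurableSpaceBorel (X : Type*) [TopologicalSpace X] :
    MeasurableSpace (StoneCech X) :=
  borel (StoneCech X)

instance StoneCech.instBorelSpace (X : Type*) [TopologicalSpace X] : BorelSpace (StoneCech X) :=
  ⟨rfl⟩

/-- The continuous extension to `βG` of the left translation `x ↦ g x` of the discrete group `G`. -/
noncomputable def stoneCechLeftTranslation {G : Type*} [Group G] [TopologicalSpace G]
    [DiscreteTopology G] (g : G) : StoneCech G → StoneCech G :=
  stoneCechExtend (g := fun x : G => stoneCechUnit (g * x)) continuous_of_discreteTopology

/-- There is a regular Borel probability measure on `βG` that is invariant under the action of `G`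
on `βG` extending left translations. -/
def HasInvariantStoneCechMeasure (G : Type*) [Group G] [TopologicalSpace G]
    [DiscreteTopology G] : Prop :=
  ∃ μ : Measure (StoneCech G), IsProbabilityMeasure μ ∧ μ.Regular ∧
    ∀ g : G, μ.map (stoneCechLeftTranslation g) = μ

/-- Følner's condition. -/
def FolnerCondition (G : Type*) [Group G] : Prop :=
  ∀ (F : Finset G) (ε : ℝ), 0 < ε → ∃ Φ : Finset G, ∀ g ∈ F,
    (((g • (Φ : Set G)) ∆ (Φ : Set G)).ncard : ℝ) < ε * (Φ.card : ℝ)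

/-- Reiter's condition (P1). -/
def ReiterConditionP1 (G : Type*) [Group G] : Prop :=
  ∀ (F : Finset G) (ε : ℝ), 0 < ε → ∃ f : lp (fun _ : G => ℂ) 1, ‖f‖ = 1 ∧
    ∀ g ∈ F, ‖f - leftTranslate g f‖ < ε

/-!
The absence of paradoxical decompositions implies Følner's condition, which implies Reiter's
condition, which yields an invariant mean, hence an invariant finitely additive probability, which
excludes paradoxical decompositions. An invariant mean also yields an invariant measure on `βG`,
and such a measure in turn yields an invariant finitely additive probability.

The heart is the construction of Følner sets. If Følner's condition fails, there is a finite set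
`K ∋ 1` and a factor `q > 1` with `|KΦ| ≥ q|Φ|` for every finite `Φ` (`card_mul_ge_of_symmDiff`),
so a power `S` of `K` satisfies `|SΦ| ≥ 2|Φ|`. This is Hall's condition for the family
`(x, b) ↦ Sx` indexed by `G × Bool`, and a system of distinct representatives of that family is a
paradoxical decomposition (`hasParadoxicalDecomposition_of_doubling`). Only one-sided matchings are
needed, so no Schröder–Bernstein argument enters.

Følner sets give Reiter functions by normalising their indicators
(`FolnerCondition.reiterConditionP1`). A Reiter function `f` gives a mean `h ↦ ∑ |f(x)| h(x)` which
is invariant up to `‖f - ᵍf‖₁`, and an ultralimit of such means is exactly invariant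
(`ReiterConditionP1.exists_isLeftInvariantMean`). Evaluating a mean on indicators gives an invariant
finitely additive probability, which visibly excludes paradoxical decompositions.

For the Stone–Čech compactification, an invariant mean restricts to a positive functional on
`C(βG)`, represented by a regular measure through the Riesz–Markov–Kakutani theorem, and
uniqueness in that theorem gives invariance (`IsLeftInvariantMean.hasInvariantStoneCechMeasure`).
Conversely, an invariant measure on `βG` is evaluated on the clopen sets that correspond to the
subsets of `G`.
-/

/-! ### Invariant measures exclude paradoxical decompositions -/

namespace IsInvariantFinitelyAdditiveProbability

variable {G : Type*} [Group G] {μ : Set G → ℝ}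

theorem empty (hμ : IsInvariantFinitelyAdditiveProbability μ) : μ ∅ = 0 := by
  have h := hμ.union ∅ ∅ (Set.disjoint_empty _)
  rw [Set.union_empty] at h
  linarith

theorem mono (hμ : IsInvariantFinitelyAdditiveProbability μ) {A B : Set G} (h : A ⊆ B) :
    μ A ≤ μ B := by
  have h1 := hμ.union A (B \ A) Set.disjoint_sdiff_right
  rw [Set.union_sdiff_cancel h] at h1
  linarith [hμ.nonneg (B \ A)]

theorem union_le (hμ : IsInvariantFinitelyAdditiveProbability μ) (A B : Set G) :
    μ (A ∪ B) ≤ μ A + μ B := by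
  rw [← Set.union_sdiff_self, hμ.union _ _ Set.disjoint_sdiff_right]
  linarith [hμ.mono (Set.sdiff_subset : B \ A ⊆ B)]

theorem biUnion_le {ι : Type*} (hμ : IsInvariantFinitelyAdditiveProbability μ) (s : Finset ι)
    (C : ι → Set G) : μ (⋃ i ∈ s, C i) ≤ ∑ i ∈ s, μ (C i) := by
  classical
  induction s using Finset.induction_on with
  | empty => simp [hμ.empty]
  | insert a s ha ih =>
    rw [Finset.set_biUnion_insert, Finset.sum_insert ha]
    linarith [hμ.union_le (C a) (⋃ i ∈ s, C i)]

theorem biUnion_eq {ι : Type*} (hμ : IsInvariantFinitelyAdditiveProbability μ) (s : Finset ι)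
    {C : ι → Set G} (hC : Pairwise (Disjoint on C)) :
    μ (⋃ i ∈ s, C i) = ∑ i ∈ s, μ (C i) := by
  classical
  induction s using Finset.induction_on with
  | empty => simp [hμ.empty]
  | insert a s ha ih =>
    rw [Finset.set_biUnion_insert, Finset.sum_insert ha, hμ.union, ih]
    simp only [Set.disjoint_iUnion_right]
    exact fun i hi => hC fun h => ha (h ▸ hi)

/-- If finitely many translates of sets cover the group, the measures of the sets sum to at
least `1`. -/
theorem one_le_sum {n : ℕ} (hμ : IsInvariantFinitelyAdditiveProbability μ) {A : Fin n → Set G}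
    {g : Fin n → G} (h : (⋃ i, g i • A i) = Set.univ) : 1 ≤ ∑ i, μ (A i) := by
  have h1 := hμ.biUnion_le Finset.univ fun i => g i • A i
  simpa [h, hμ.univ, hμ.smul] using h1

theorem not_hasParadoxicalDecomposition (hμ : IsInvariantFinitelyAdditiveProbability μ) :
    ¬ HasParadoxicalDecomposition G := by
  rintro ⟨n, m, A, B, g, h, hd, hA, hB⟩
  have h1 := hμ.biUnion_eq Finset.univ hd
  rw [Fintype.sum_sum_type] at h1
  simp only [Sum.elim_inl, Sum.elim_inr] at h1
  have h2 := hμ.mono (Set.subset_univ (⋃ i ∈ Finset.univ, Sum.elim A B i))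
  rw [hμ.univ] at h2
  linarith [hμ.one_le_sum hA, hμ.one_le_sum hB]

end IsInvariantFinitelyAdditiveProbability

/-! ### Følner's condition from the absence of paradoxical decompositions -/

section Folner

variable {G : Type*} [Group G]

/-- If a finite set `S` multiplies the size of every finite set by at least two, Hall's marriage
theorem provides two injections `G → G` with disjoint images, both moving every point by left
multiplication with an element of `S`; cutting the images according to that element is a
paradoxical decomposition. -/
theorem hasParadoxicalDecomposition_of_doubling [DecidableEq G] (S : Finset G)
    (hS : ∀ Φ : Finset G, 2 * Φ.card ≤ (S * Φ).card) : HasParadoxicalDecomposition G := by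
  obtain ⟨f, hf, hfS⟩ := (Finset.all_card_le_biUnion_card_iff_exists_injective
    (fun p : G × Bool => S * {p.1})).1 fun s => by
      have h1 : s.biUnion (fun p : G × Bool => S * {p.1}) = S * s.image Prod.fst := by
        ext x
        simp [Finset.mem_mul]
        grind
      have h2 : s ⊆ s.image Prod.fst ×ˢ (Finset.univ : Finset Bool) := fun p hp =>
        Finset.mk_mem_product (Finset.mem_image_of_mem _ hp) (Finset.mem_univ _)
      have h3 := Finset.card_le_card h2
      rw [Finset.card_product, Finset.card_univ, Fintype.card_bool] at h3
      rw [h1]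
      linarith [hS (s.image Prod.fst)]
  let e : Fin S.card → G := fun i => (S.equivFin.symm i : G)
  have he : Injective e := Subtype.val_injective.comp S.equivFin.symm.injective
  let P : Bool → Fin S.card → Set G := fun b i => {y | ∃ x, f (x, b) = y ∧ y = e i * x}
  have hdisj : ∀ b c i j, (b, i) ≠ (c, j) → Disjoint (P b i) (P c j) := by
    intro b c i j hne
    rw [Set.disjoint_left]
    rintro _ ⟨x, rfl, hx⟩ ⟨x', hxx', hx'⟩
    obtain ⟨rfl, rfl⟩ := Prod.mk.inj (hf hxx')
    exact hne (by rw [he (mul_right_cancel (hx.symm.trans hx'))])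
  have hcover : ∀ b, (⋃ i, (e i)⁻¹ • P b i) = Set.univ := by
    intro b
    refine Set.eq_univ_of_forall fun x => Set.mem_iUnion.2 ?_
    have h := hfS (x, b)
    rw [Finset.mem_mul] at h
    obtain ⟨s, hs, y, hy, hsy⟩ := h
    rw [Finset.mem_singleton.1 hy] at hsy
    refine ⟨S.equivFin ⟨s, hs⟩, ?_⟩
    rw [Set.mem_smul_set_iff_inv_smul_mem, inv_inv]
    exact ⟨x, by simp [e, hsy], by simp⟩
  refine ⟨S.card, S.card, P true, P false, fun i => (e i)⁻¹, fun i => (e i)⁻¹, ?_,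
    hcover true, hcover false⟩
  rintro (i | i) (j | j) hij <;> refine hdisj _ _ _ _ ?_ <;> simp_all

/-- A set containing `1` and an element `g` that moves `Φ` substantially enlarges `Φ`. -/
theorem card_mul_ge_of_symmDiff [DecidableEq G] {K Φ : Finset G} {g : G} {ε : ℝ} (h1 : 1 ∈ K)
    (hg : g ∈ K) (h : ε * (Φ.card : ℝ) ≤ (((g • (Φ : Set G)) ∆ (Φ : Set G)).ncard : ℝ)) :
    (1 + ε / 2) * (Φ.card : ℝ) ≤ ((K * Φ).card : ℝ) := by
  have hcoe : (g • (Φ : Set G)) ∆ (Φ : Set G) = (((g • Φ) ∆ Φ : Finset G) : Set G) := by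
    rw [Finset.coe_symmDiff, Finset.coe_smul_finset]
  have hcomm : ((g • Φ) \ Φ).card = (Φ \ (g • Φ)).card :=
    Finset.card_sdiff_comm (Finset.card_smul_finset g Φ)
  have hsymm : ((g • Φ) ∆ Φ).card = 2 * ((g • Φ) \ Φ).card := by
    rw [symmDiff_def, Finset.sup_eq_union,
      Finset.card_union_of_disjoint disjoint_sdiff_sdiff, ← hcomm, two_mul]
  have hsub : Φ ∪ (g • Φ) \ Φ ⊆ K * Φ := by
    refine Finset.union_subset (Finset.subset_mul_right Φ h1) ?_
    refine Finset.sdiff_subset.trans fun x hx => ?_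
    obtain ⟨y, hy, rfl⟩ := Finset.mem_smul_finset.1 hx
    exact Finset.mul_mem_mul hg hy
  have hcard := Finset.card_le_card hsub
  rw [Finset.card_union_of_disjoint Finset.disjoint_sdiff] at hcard
  rw [hcoe, Set.ncard_coe_finset, hsymm] at h
  have hcard' : (Φ.card : ℝ) + (((g • Φ) \ Φ).card : ℝ) ≤ ((K * Φ).card : ℝ) := by
    exact_mod_cast hcard
  push_cast at h
  linarith

/-- If Følner's condition fails, some finite set expands every finite set by a fixed factor
greater than `1`, hence one of its powers expands by a factor of at least `2`. -/
theorem folnerCondition_of_not_hasParadoxicalDecomposition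
    (h : ¬ HasParadoxicalDecomposition G) : FolnerCondition G := by
  classical
  by_contra hF
  apply h
  simp only [FolnerCondition, not_forall, not_exists, not_lt] at hF
  obtain ⟨F, ε, hε, hF⟩ := hF
  let K : Finset G := insert 1 F
  have hK : ∀ Φ : Finset G, (1 + ε / 2) * (Φ.card : ℝ) ≤ ((K * Φ).card : ℝ) := by
    intro Φ
    obtain ⟨g, hg, hle⟩ := hF Φ
    exact card_mul_ge_of_symmDiff (Finset.mem_insert_self _ _) (Finset.mem_insert_of_mem hg) hle
  have hpow : ∀ (n : ℕ) (Φ : Finset G),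
      (1 + ε / 2) ^ n * (Φ.card : ℝ) ≤ ((K ^ n * Φ).card : ℝ) := by
    intro n Φ
    induction n with
    | zero => simp
    | succ n ih =>
      calc (1 + ε / 2) ^ (n + 1) * (Φ.card : ℝ)
          = (1 + ε / 2) * ((1 + ε / 2) ^ n * (Φ.card : ℝ)) := by ring
        _ ≤ (1 + ε / 2) * ((K ^ n * Φ).card : ℝ) := by gcongr
        _ ≤ ((K * (K ^ n * Φ)).card : ℝ) := hK _
        _ = ((K ^ (n + 1) * Φ).card : ℝ) := by rw [← mul_assoc, ← pow_succ']
  obtain ⟨n, hn⟩ := pow_unbounded_of_one_lt (2 : ℝ) (by linarith : 1 < 1 + ε / 2)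
  refine hasParadoxicalDecomposition_of_doubling (K ^ n) fun Φ => ?_
  have h2 : (2 : ℝ) * (Φ.card : ℝ) ≤ ((K ^ n * Φ).card : ℝ) :=
    (mul_le_mul_of_nonneg_right hn.le (Nat.cast_nonneg _)).trans (hpow n Φ)
  exact_mod_cast h2

end Folner

/-! ### Reiter's condition and invariant means -/

section Means

open Filter Topology

variable {α G : Type*} [Group G]

theorem leftTranslate_apply {p : ℝ≥0∞} (g : G) (f : lp (fun _ : G => ℂ) p) (x : G) :
    leftTranslate g f x = f (g⁻¹ * x) := rfl

theorem lp.hasSum_norm_one (f : lp (fun _ : α => ℂ) 1) :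
    HasSum (fun x => ‖f x‖) ‖f‖ := by
  simpa using lp.hasSum_norm (by simp : 0 < (1 : ℝ≥0∞).toReal) f

/-- The indicator function of a subset, as a bounded function. -/
noncomputable def boundedIndicator (A : Set α) : lp (fun _ : α => ℂ) ∞ :=
  ⟨A.indicator 1, memℓp_infty ⟨1, by
    rintro _ ⟨x, rfl⟩
    by_cases hx : x ∈ A <;> simp [hx]⟩⟩

theorem boundedIndicator_apply (A : Set α) (x : α) :
    boundedIndicator A x = A.indicator (1 : α → ℂ) x := rfl

theorem leftTranslate_boundedIndicator (g : G) (A : Set G) :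
    leftTranslate g (boundedIndicator A) = boundedIndicator (g • A) := by
  ext x
  rw [leftTranslate_apply, boundedIndicator_apply, boundedIndicator_apply]
  by_cases hx : g⁻¹ * x ∈ A <;> simp [Set.mem_smul_set_iff_inv_smul_mem, hx]

/-- An invariant mean, evaluated on indicator functions, is an invariant finitely additive
probability. -/
theorem IsLeftInvariantMean.isInvariantFinitelyAdditiveProbability
    {φ : lp (fun _ : G => ℂ) ∞ →ₗ[ℂ] ℂ} (hφ : IsLeftInvariantMean φ) :
    IsInvariantFinitelyAdditiveProbability fun A : Set G => (φ (boundedIndicator A)).re where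
  nonneg A := by
    refine (Complex.le_def.1 (hφ.nonneg _ fun x => ?_)).1
    by_cases hx : x ∈ A <;> simp [boundedIndicator_apply, hx]
  univ := by
    have h : boundedIndicator (Set.univ : Set G) = 1 := by
      ext x
      simp [boundedIndicator_apply]
    simp [h, hφ.map_one]
  union A B hAB := by
    have h : boundedIndicator (A ∪ B) = boundedIndicator A + boundedIndicator B := by
      ext x
      simp [boundedIndicator_apply, Set.indicator_union_of_disjoint hAB]
    simp [h]
  smul g A := by
    rw [← leftTranslate_boundedIndicator, hφ.map_leftTranslate]

/-- The normalised indicator functions of Følner sets witness Reiter's condition. -/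
theorem FolnerCondition.reiterConditionP1 (h : FolnerCondition G) : ReiterConditionP1 G := by
  classical
  intro F ε hε
  -- Adding `1` to `F` forces the Følner set to be nonempty.
  obtain ⟨Φ, hΦ⟩ := h (insert 1 F) ε hε
  have hpos : 0 < (Φ.card : ℝ) := by
    have h1 := hΦ 1 (Finset.mem_insert_self _ _)
    rw [one_smul, symmDiff_self] at h1
    simp only [Set.bot_eq_empty, Set.ncard_empty, Nat.cast_zero] at h1
    exact pos_of_mul_pos_right h1 hε.le
  let u : G → ℂ := (Φ : Set G).indicator fun _ => (Φ.card : ℂ)⁻¹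
  have hu : Memℓp u 1 := by
    refine (memℓp_zero (Φ.finite_toSet.subset fun x hx => ?_)).of_exponent_ge zero_le_one
    by_contra hxΦ
    exact hx (Set.indicator_of_notMem hxΦ _)
  refine ⟨⟨u, hu⟩, ?_, fun g hg => ?_⟩
  · refine (lp.hasSum_norm_one _).unique ?_
    have h1 : HasSum (fun x => ‖u x‖) (∑ x ∈ Φ, ‖u x‖) := by
      refine hasSum_sum_of_ne_finset_zero fun x hx => ?_
      simp [u, hx]
    have h2 : ∑ x ∈ Φ, ‖u x‖ = 1 := by
      rw [Finset.sum_congr rfl (g := fun _ => (Φ.card : ℝ)⁻¹) fun x hx => by simp [u, hx]]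
      simp [hpos.ne']
    rwa [h2] at h1
  · have hcoe : (g • (Φ : Set G)) ∆ (Φ : Set G) = (((g • Φ) ∆ Φ : Finset G) : Set G) := by
      rw [Finset.coe_symmDiff, Finset.coe_smul_finset]
    have hval : ∀ x, ‖(⟨u, hu⟩ - leftTranslate g ⟨u, hu⟩ : lp (fun _ : G => ℂ) 1) x‖ =
        if x ∈ (g • Φ) ∆ Φ then (Φ.card : ℝ)⁻¹ else 0 := by
      intro x
      have hx : (⟨u, hu⟩ - leftTranslate g ⟨u, hu⟩ : lp (fun _ : G => ℂ) 1) x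
          = u x - u (g⁻¹ * x) := rfl
      rw [hx]
      by_cases h1 : x ∈ Φ <;> by_cases h2 : g⁻¹ * x ∈ Φ <;>
        simp [u, h1, h2, Finset.mem_symmDiff, ← Finset.inv_smul_mem_iff]
    have hsum : HasSum
        (fun x => ‖(⟨u, hu⟩ - leftTranslate g ⟨u, hu⟩ : lp (fun _ : G => ℂ) 1) x‖)
        (((g • Φ) ∆ Φ).card * (Φ.card : ℝ)⁻¹) := by
      have h3 := hasSum_sum_of_ne_finset_zero (L := .unconditional G) (s := (g • Φ) ∆ Φ)
        (f := fun x => if x ∈ (g • Φ) ∆ Φ then (Φ.card : ℝ)⁻¹ else 0)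
        fun x hx => if_neg hx
      rw [Finset.sum_congr rfl fun x hx => if_pos hx, Finset.sum_const, nsmul_eq_mul] at h3
      simpa only [hval] using h3
    rw [(lp.hasSum_norm_one _).unique hsum]
    have h4 := hΦ g (Finset.mem_insert_of_mem hg)
    rw [hcoe, Set.ncard_coe_finset] at h4
    rwa [← div_eq_mul_inv, div_lt_iff₀ hpos]

/-- The average of a bounded function `h` with respect to the weight `|f|`. -/
noncomputable def weightedAverage (f : lp (fun _ : α => ℂ) 1) (h : lp (fun _ : α => ℂ) ∞) : ℂ :=
  ∑' x, (‖f x‖ : ℂ) * h x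

theorem summable_weightedAverage (f : lp (fun _ : α => ℂ) 1) (h : lp (fun _ : α => ℂ) ∞) :
    Summable fun x => (‖f x‖ : ℂ) * h x := by
  refine Summable.of_norm_bounded ((lp.hasSum_norm_one f).summable.mul_right ‖h‖) fun x => ?_
  rw [norm_mul, Complex.norm_real, norm_norm]
  gcongr
  exact lp.norm_apply_le_norm (by simp) h x

theorem norm_weightedAverage_le (f : lp (fun _ : α => ℂ) 1) (h : lp (fun _ : α => ℂ) ∞) :
    ‖weightedAverage f h‖ ≤ ‖f‖ * ‖h‖ := by
  refine tsum_of_norm_bounded ((lp.hasSum_norm_one f).mul_right ‖h‖) fun x => ?_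
  rw [norm_mul, Complex.norm_real, norm_norm]
  gcongr
  exact lp.norm_apply_le_norm (by simp) h x

theorem weightedAverage_add (f : lp (fun _ : α => ℂ) 1) (h k : lp (fun _ : α => ℂ) ∞) :
    weightedAverage f (h + k) = weightedAverage f h + weightedAverage f k := by
  rw [weightedAverage, weightedAverage, weightedAverage,
    ← (summable_weightedAverage f h).tsum_add (summable_weightedAverage f k)]
  simp [mul_add]

theorem weightedAverage_smul (f : lp (fun _ : α => ℂ) 1) (c : ℂ) (h : lp (fun _ : α => ℂ) ∞) :
    weightedAverage f (c • h) = c * weightedAverage f h := by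
  rw [weightedAverage, weightedAverage, ← tsum_mul_left]
  exact tsum_congr fun x => by simp [mul_left_comm]

theorem weightedAverage_one (f : lp (fun _ : α => ℂ) 1) : weightedAverage f 1 = (‖f‖ : ℂ) := by
  have h : HasSum (fun x => ((‖f x‖ : ℝ) : ℂ)) (‖f‖ : ℂ) :=
    Complex.hasSum_ofReal.2 (lp.hasSum_norm_one f)
  simpa [weightedAverage] using h.tsum_eq

theorem weightedAverage_nonneg (f : lp (fun _ : α => ℂ) 1) {h : lp (fun _ : α => ℂ) ∞}
    (hh : ∀ x, 0 ≤ h x) : 0 ≤ weightedAverage f h :=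
  tsum_nonneg fun x => mul_nonneg (by simp) (hh x)

/-- An almost invariant weight gives an almost invariant average: after the substitution
`x ↦ g⁻¹x` in one of the two sums, the difference is a sum weighted by `|f(x)| - |f(g⁻¹x)|`. -/
theorem norm_weightedAverage_leftTranslate_sub_le (g : G) (f : lp (fun _ : G => ℂ) 1)
    (h : lp (fun _ : G => ℂ) ∞) :
    ‖weightedAverage f (leftTranslate g h) - weightedAverage f h‖ ≤
      ‖f - leftTranslate g f‖ * ‖h‖ := by
  have h1 : weightedAverage f h = ∑' x, (‖f (g⁻¹ * x)‖ : ℂ) * h (g⁻¹ * x) :=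
    ((Equiv.mulLeft g⁻¹).tsum_eq fun x => (‖f x‖ : ℂ) * h x).symm
  have h2 : Summable fun x => (‖f (g⁻¹ * x)‖ : ℂ) * h (g⁻¹ * x) :=
    (summable_weightedAverage f h).comp_injective (mul_right_injective g⁻¹)
  rw [h1, weightedAverage, ← (summable_weightedAverage f _).tsum_sub h2]
  refine tsum_of_norm_bounded ((lp.hasSum_norm_one (f - leftTranslate g f)).mul_right ‖h‖)
    fun x => ?_
  rw [leftTranslate_apply, ← sub_mul, norm_mul, ← Complex.ofReal_sub, Complex.norm_real]
  exact mul_le_mul (abs_norm_sub_norm_le (f x) (f (g⁻¹ * x)))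
    (lp.norm_apply_le_norm (by simp) h _) (norm_nonneg _) (norm_nonneg _)

/-- A limit, along an ultrafilter, of averages with respect to more and more invariant weights
is an invariant mean. -/
theorem ReiterConditionP1.exists_isLeftInvariantMean (hR : ReiterConditionP1 G) :
    ∃ φ : lp (fun _ : G => ℂ) ∞ →ₗ[ℂ] ℂ, IsLeftInvariantMean φ := by
  classical
  choose f hf1 hf using fun i : Finset G × ℕ =>
    hR i.1 (1 / ((i.2 : ℝ) + 1)) Nat.one_div_pos_of_nat
  let U : Ultrafilter (Finset G × ℕ) := Ultrafilter.of atTop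
  have hU : (U : Filter (Finset G × ℕ)) ≤ atTop := Ultrafilter.of_le _
  have hlim : ∀ h : lp (fun _ : G => ℂ) ∞,
      ∃ z, Tendsto (fun i => weightedAverage (f i) h) U (𝓝 z) := by
    intro h
    obtain ⟨z, -, hz⟩ := (isCompact_closedBall (0 : ℂ) ‖h‖).ultrafilter_le_nhds
      (U.map fun i => weightedAverage (f i) h) (by
        rw [le_principal_iff, Ultrafilter.mem_coe, Ultrafilter.mem_map]
        refine Filter.univ_mem' fun i => ?_
        simpa [hf1] using norm_weightedAverage_le (f i) h)
    exact ⟨z, hz⟩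
  choose φ hφ using hlim
  refine ⟨{ toFun := φ, map_add' := fun h k => ?_, map_smul' := fun c h => ?_ }, ?_, ?_, ?_⟩
  · refine tendsto_nhds_unique (hφ (h + k)) ?_
    simpa only [weightedAverage_add] using (hφ h).add (hφ k)
  · refine tendsto_nhds_unique (hφ (c • h)) ?_
    simpa only [weightedAverage_smul, RingHom.id_apply, smul_eq_mul] using (hφ h).const_mul c
  · exact fun h hh => ge_of_tendsto' (hφ h) fun i => weightedAverage_nonneg (f i) hh
  · refine tendsto_nhds_unique (hφ 1) ?_
    simp [weightedAverage_one, hf1]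
  · intro g h
    have hsmall : Tendsto (fun i : Finset G × ℕ => 1 / ((i.2 : ℝ) + 1) * ‖h‖) atTop (𝓝 0) := by
      have h0 : Tendsto (fun i : Finset G × ℕ => i.2) atTop atTop :=
        tendsto_snd.mono_left prod_atTop_atTop_eq.ge
      simpa using (tendsto_one_div_add_atTop_nhds_zero_nat.comp h0).mul_const ‖h‖
    have hdiff : Tendsto (fun i => weightedAverage (f i) (leftTranslate g h) -
        weightedAverage (f i) h) U (𝓝 0) := by
      refine squeeze_zero_norm' ?_ (hsmall.mono_left hU)
      refine hU ((eventually_ge_atTop ({g}, 0)).mono fun i hi => ?_)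
      refine (norm_weightedAverage_leftTranslate_sub_le g (f i) h).trans ?_
      gcongr
      exact (hf i g (hi.1 (Finset.mem_singleton_self g))).le
    exact sub_eq_zero.1 (tendsto_nhds_unique ((hφ (leftTranslate g h)).sub (hφ h)) hdiff)

end Means

/-! ### Invariant measures on the Stone–Čech compactification -/

section StoneCech

open scoped CompactlySupported

variable {α G : Type*} [TopologicalSpace α] [Group G] [TopologicalSpace G] [DiscreteTopology G]

theorem continuous_stoneCechLeftTranslation (g : G) :
    Continuous (stoneCechLeftTranslation g) :=
  continuous_stoneCechExtend _

theorem stoneCechLeftTranslation_unit (g x : G) :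
    stoneCechLeftTranslation g (stoneCechUnit x) = stoneCechUnit (g * x) :=
  stoneCechExtend_stoneCechUnit _ x

theorem stoneCechLeftTranslation_comp (g h : G) :
    stoneCechLeftTranslation g ∘ stoneCechLeftTranslation h = stoneCechLeftTranslation (g * h) := by
  refine stoneCech_hom_ext ((continuous_stoneCechLeftTranslation g).comp
    (continuous_stoneCechLeftTranslation h)) (continuous_stoneCechLeftTranslation _) ?_
  ext x
  simp [stoneCechLeftTranslation_unit, mul_assoc]

theorem stoneCechLeftTranslation_one :
    stoneCechLeftTranslation (1 : G) = id := by
  refine stoneCech_hom_ext (continuous_stoneCechLeftTranslation _) continuous_id ?_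
  ext x
  simp [stoneCechLeftTranslation_unit]

/-- The left translations of `βG` are homeomorphisms. -/
noncomputable def stoneCechLeftTranslationHomeomorph (g : G) : StoneCech G ≃ₜ StoneCech G where
  toFun := stoneCechLeftTranslation g
  invFun := stoneCechLeftTranslation g⁻¹
  left_inv y := by
    simpa [stoneCechLeftTranslation_one] using congrFun (stoneCechLeftTranslation_comp g⁻¹ g) y
  right_inv y := by
    simpa [stoneCechLeftTranslation_one] using congrFun (stoneCechLeftTranslation_comp g g⁻¹) y
  continuous_toFun := continuous_stoneCechLeftTranslation g
  continuous_invFun := continuous_stoneCechLeftTranslation g⁻¹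

/-- The restriction to `α` of a real continuous function on `βα`, as a bounded function. -/
noncomputable def restrictStoneCech (f : C_c(StoneCech α, ℝ)) : lp (fun _ : α => ℂ) ∞ :=
  ⟨fun x => (f (stoneCechUnit x) : ℂ), memℓp_infty ⟨‖f.toBoundedContinuousFunction‖, by
    rintro _ ⟨x, rfl⟩
    refine (Complex.norm_real _).trans_le ?_
    exact f.toBoundedContinuousFunction.norm_coe_le_norm (stoneCechUnit x)⟩⟩

theorem restrictStoneCech_apply (f : C_c(StoneCech α, ℝ)) (x : α) :
    restrictStoneCech f x = (f (stoneCechUnit x) : ℂ) := rfl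

/-- The positive functional on the continuous functions on `βG` induced by an invariant mean. -/
noncomputable def IsLeftInvariantMean.stoneCechFunctional {φ : lp (fun _ : G => ℂ) ∞ →ₗ[ℂ] ℂ}
    (hφ : IsLeftInvariantMean φ) : C_c(StoneCech G, ℝ) →ₚ[ℝ] ℝ :=
  PositiveLinearMap.mk₀
    { toFun := fun f => (φ (restrictStoneCech f)).re
      map_add' := fun f k => by
        have h : restrictStoneCech (f + k) = restrictStoneCech f + restrictStoneCech k := by
          ext x
          simp [restrictStoneCech_apply]
        simp [h]
      map_smul' := fun c f => by
        have h : restrictStoneCech (c • f) = (c : ℂ) • restrictStoneCech f := by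
          ext x
          rw [lp.coeFn_smul]
          simp [restrictStoneCech_apply]
        simp [h] }
    fun f hf => (Complex.le_def.1 (hφ.nonneg _ fun x => by
      simpa [restrictStoneCech_apply] using hf (stoneCechUnit x))).1

/-- The measure representing an invariant mean through the Riesz–Markov–Kakutani theorem is
invariant: both it and its translate are regular, so it suffices to compare integrals of continuous
functions. -/
theorem IsLeftInvariantMean.hasInvariantStoneCechMeasure {φ : lp (fun _ : G => ℂ) ∞ →ₗ[ℂ] ℂ}
    (hφ : IsLeftInvariantMean φ) : HasInvariantStoneCechMeasure G := by
  let μ := RealRMK.rieszMeasure hφ.stoneCechFunctional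
  have hint : ∀ f : C_c(StoneCech G, ℝ), ∫ y, f y ∂μ = (φ (restrictStoneCech f)).re :=
    fun f => RealRMK.integral_rieszMeasure _ f
  refine ⟨μ, ⟨?_⟩, inferInstanceAs (RealRMK.rieszMeasure _).Regular, fun g => ?_⟩
  · have h := hint (CompactlySupportedContinuousMap.continuousMapEquiv 1)
    have h1 : restrictStoneCech (CompactlySupportedContinuousMap.continuousMapEquiv
        (1 : C(StoneCech G, ℝ))) = 1 := by
      ext x
      simp [restrictStoneCech_apply]
    rw [h1, hφ.map_one] at h
    have h2 : μ.real Set.univ = 1 := by simpa using h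
    rwa [Measure.real, ENNReal.toReal_eq_one_iff] at h2
  · have : μ.Regular := inferInstanceAs (RealRMK.rieszMeasure _).Regular
    have : IsFiniteMeasure μ := inferInstanceAs (IsFiniteMeasure (RealRMK.rieszMeasure _))
    have hreg : (μ.map (stoneCechLeftTranslation g)).Regular :=
      Measure.Regular.map (stoneCechLeftTranslationHomeomorph g)
    refine Measure.ext_of_integral_eq_on_compactlySupported fun f => ?_
    let fg : C_c(StoneCech G, ℝ) := CompactlySupportedContinuousMap.continuousMapEquiv
      ⟨fun y => f (stoneCechLeftTranslation g y),
        f.continuous.comp (continuous_stoneCechLeftTranslation g)⟩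
    have h3 : restrictStoneCech fg = leftTranslate g⁻¹ (restrictStoneCech f) := by
      ext x
      rw [leftTranslate_apply, restrictStoneCech_apply, restrictStoneCech_apply, inv_inv,
        ← stoneCechLeftTranslation_unit]
      rfl
    calc ∫ y, f y ∂(μ.map (stoneCechLeftTranslation g))
        = ∫ y, fg y ∂μ :=
          integral_map (continuous_stoneCechLeftTranslation g).aemeasurable
            f.continuous.aestronglyMeasurable
      _ = ∫ y, f y ∂μ := by rw [hint, hint, h3, hφ.map_leftTranslate]

variable [DiscreteTopology α]

open Classical in
/-- The continuous extension to `βα` of the characteristic function of `A ⊆ α`. -/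
noncomputable def stoneCechCharFun (A : Set α) : StoneCech α → Bool :=
  stoneCechExtend (g := fun x : α => decide (x ∈ A)) continuous_of_discreteTopology

theorem continuous_stoneCechCharFun (A : Set α) : Continuous (stoneCechCharFun A) :=
  continuous_stoneCechExtend _

open Classical in
theorem stoneCechCharFun_unit (A : Set α) (x : α) :
    stoneCechCharFun A (stoneCechUnit x) = decide (x ∈ A) :=
  stoneCechExtend_stoneCechUnit _ x

theorem stoneCechCharFun_univ (y : StoneCech α) : stoneCechCharFun (Set.univ : Set α) y = true := by
  refine congrFun (stoneCech_hom_ext (g₂ := fun _ => true) (continuous_stoneCechCharFun _)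
    continuous_const ?_) y
  ext x
  simp [stoneCechCharFun_unit]

theorem stoneCechCharFun_union (A B : Set α) (y : StoneCech α) :
    stoneCechCharFun (A ∪ B) y = (stoneCechCharFun A y || stoneCechCharFun B y) := by
  refine congrFun (stoneCech_hom_ext
    (g₂ := fun y => (stoneCechCharFun A y || stoneCechCharFun B y))
    (continuous_stoneCechCharFun _) ?_ ?_) y
  · exact (continuous_of_discreteTopology (f := fun p : Bool × Bool => (p.1 || p.2))).comp
      ((continuous_stoneCechCharFun A).prodMk (continuous_stoneCechCharFun B))
  · ext x
    by_cases hA : x ∈ A <;> simp [stoneCechCharFun_unit, hA]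

theorem stoneCechCharFun_and_of_disjoint {A B : Set α} (h : Disjoint A B) (y : StoneCech α) :
    (stoneCechCharFun A y && stoneCechCharFun B y) = false := by
  refine congrFun (stoneCech_hom_ext
    (g₁ := fun y => (stoneCechCharFun A y && stoneCechCharFun B y)) (g₂ := fun _ => false)
    ?_ continuous_const ?_) y
  · exact (continuous_of_discreteTopology (f := fun p : Bool × Bool => (p.1 && p.2))).comp
      ((continuous_stoneCechCharFun A).prodMk (continuous_stoneCechCharFun B))
  · ext x
    simpa [stoneCechCharFun_unit] using fun hA => Set.disjoint_left.1 h hA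

theorem stoneCechCharFun_smul (g : G) (A : Set G) (y : StoneCech G) :
    stoneCechCharFun (g • A) (stoneCechLeftTranslation g y) = stoneCechCharFun A y := by
  refine congrFun (stoneCech_hom_ext
    (g₁ := stoneCechCharFun (g • A) ∘ stoneCechLeftTranslation g)
    ((continuous_stoneCechCharFun _).comp (continuous_stoneCechLeftTranslation g))
    (continuous_stoneCechCharFun A) ?_) y
  ext x
  simp [stoneCechCharFun_unit, stoneCechLeftTranslation_unit, Set.mem_smul_set_iff_inv_smul_mem]

/-- The clopen subset of `βα` determined by `A ⊆ α`, namely the closure of `A` in `βα`; it is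
encoded as the set where the extended characteristic function is `true`. -/
def stoneCechClopen (A : Set α) : Set (StoneCech α) := stoneCechCharFun A ⁻¹' {true}

theorem measurableSet_stoneCechClopen (A : Set α) : MeasurableSet (stoneCechClopen A) :=
  ((isOpen_discrete _).preimage (continuous_stoneCechCharFun A)).measurableSet

theorem HasInvariantStoneCechMeasure.exists_isInvariantFinitelyAdditiveProbability
    (h : HasInvariantStoneCechMeasure G) :
    ∃ μ : Set G → ℝ, IsInvariantFinitelyAdditiveProbability μ := by
  obtain ⟨μ, hμ, -, hinv⟩ := h
  refine ⟨fun A => μ.real (stoneCechClopen A), fun A => measureReal_nonneg, ?_, ?_, ?_⟩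
  · have h1 : stoneCechClopen (Set.univ : Set G) = Set.univ :=
      Set.eq_univ_of_forall stoneCechCharFun_univ
    simp [h1]
  · intro A B hAB
    have h1 : stoneCechClopen (A ∪ B) = stoneCechClopen A ∪ stoneCechClopen B := by
      ext y
      simp [stoneCechClopen, stoneCechCharFun_union]
    have h2 : Disjoint (stoneCechClopen A) (stoneCechClopen B) := by
      rw [Set.disjoint_left]
      intro y hA hB
      have h3 := stoneCechCharFun_and_of_disjoint hAB y
      rw [show stoneCechCharFun A y = true from hA, show stoneCechCharFun B y = true from hB] at h3
      simp at h3
    rw [h1, measureReal_union h2 (measurableSet_stoneCechClopen B)]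
  · intro g A
    have h1 : stoneCechLeftTranslation g ⁻¹' stoneCechClopen (g • A) = stoneCechClopen A := by
      ext y
      simp [stoneCechClopen, stoneCechCharFun_smul]
    have h2 := map_measureReal_apply (μ := μ) (continuous_stoneCechLeftTranslation g).measurable
      (measurableSet_stoneCechClopen (g • A))
    rwa [hinv g, h1] at h2

end StoneCech

/-! ### The equivalence -/

theorem mainTheorem5 (G : Type*) [Group G] [TopologicalSpace G] [DiscreteTopology G] :
    List.TFAE [
      ¬ HasParadoxicalDecomposition G,
      ∃ μ : Set G → ℝ, IsInvariantFinitelyAdditiveProbability μ,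
      ∃ φ : lp (fun _ : G => ℂ) ∞ →ₗ[ℂ] ℂ, IsLeftInvariantMean φ,
      HasInvariantStoneCechMeasure G,
      FolnerCondition G,
      ReiterConditionP1 G] := by
  tfae_have 1 → 5 := folnerCondition_of_not_hasParadoxicalDecomposition
  tfae_have 5 → 6 := FolnerCondition.reiterConditionP1
  tfae_have 6 → 3 := ReiterConditionP1.exists_isLeftInvariantMean
  tfae_have 3 → 2 := fun ⟨_, hφ⟩ => ⟨_, hφ.isInvariantFinitelyAdditiveProbability⟩
  tfae_have 2 → 1 := fun ⟨_, hμ⟩ => hμ.not_hasParadoxicalDecomposition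
  tfae_have 3 → 4 := fun ⟨_, hφ⟩ => hφ.hasInvariantStoneCechMeasure
  tfae_have 4 → 2 :=
    HasInvariantStoneCechMeasure.exists_isInvariantFinitelyAdditiveProbability
  tfae_finish
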